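/- Let $G$ be a complete graph (finite or infinite) whose edges are colored with arbitrary colors. Call a cycle of $G$ rainbow if no two of its edges have the same color. (There are no rainbow $2$-cycles, since a $2$-cycle traverses the same edge twice.) Let $n = 4k$ with $k \ge 1$ an integer and $n \ne 16$. If $G$ contains no rainbow $n$-cycle, then $G$ contains no rainbow $(3n-10)$-cycle. Equivalently, writing $\mathrm{Sp}(G) = \{m \ge 2 : \text{no } m\text{-cycle of } G \text{ is rainbow}\}$, if $n \in \mathrm{Sp}(G)$ then $3n-10 \in \mathrm{Sp}(G)$. -/

import Mathlib

universe u v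

namespace RainbowSpectrum

/-- A walk `p` in an edge-colored graph is rainbow if no two (distinct) edges that it uses
have the same color. -/
def IsRainbow {V : Type u} {K : Type v} {G : SimpleGraph V} (γ : G.EdgeLabeling K) {x y : V}
    (p : G.Walk x y) : Prop :=
  Set.InjOn (fun e : G.edgeSet => γ e) {e : G.edgeSet | (e : Sym2 V) ∈ p.edges}

/-- The edge-colored complete graph on `V` contains a rainbow `n`-cycle. The cycles are those of
a simple graph (so they have length at least three; a closed walk of length two, which uses the
same edge twice, is not a cycle and in particular does not give a rainbow cycle). -/
def HasRainbowCycle {V : Type u} {K : Type v} (γ : SimpleGraph.TopEdgeLabeling V K)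
    (n : ℕ) : Prop :=
  ∃ (x : V) (p : (⊤ : SimpleGraph V).Walk x x), p.IsCycle ∧ p.length = n ∧ IsRainbow γ p

/-- The spectrum of an edge-colored complete graph: all `n ≥ 2` such that no `n`-cycle is
rainbow. -/
def spectrum {V : Type u} {K : Type v} (γ : SimpleGraph.TopEdgeLabeling V K) : Set ℕ :=
  {n | 2 ≤ n ∧ ¬ HasRainbowCycle γ n}

end RainbowSpectrum

/-!
The argument is by contradiction, for `n = 4 k` with `k ≥ 3`; put `N = 3 n - 10`. (For `k = 1` there
is no cycle of length `N = 2`; for `k = 2` a chord halves a rainbow 14-cycle into two 8-cycles, and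
one of them is rainbow.) Number the vertices of a rainbow `N`-cycle by `ℤ` modulo `N`, and name the
edge from `i` to `i + 1`, as well as its color, `i`. Suppose that no `n`-cycle is rainbow.

* The chord from `i` to `i + n - 1` closes a path of `n - 1` edges to an `n`-cycle, so its color is
  that of an edge `c i` of this path (`exists_isChordColor`).
* An `n`-cycle through the two chords starting at `i` and at `i + n - 4` shows that `c i` is among
  the last three edges of its path or `c (i + n - 4)` is among the first three of its path
  (`late_or_early`). Since `3 (n - 4) = N - 2`, three such steps amount to a step by `-2`; as `N` is
  even, on each parity class either all `c i` are among the first three edges or all are among the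
  last three. The `n`-cycle through the two crossing chords starting at `i` and at `i + 2 k - 1`
  (`crossing`) links the two parity classes (`all_early_or_all_late`). After reversing the
  orientation if necessary, `i ≤ c i ≤ i + 2` for all `i`.
* The chord from `b` to `b - (n - 7)` then has the color `c b`: together with any one of the chords
  from `i` to `i + n - 1` on its longer side it lies in an `n`-cycle, and three choices of `i` leave
  only this color (`outer_chord_color`).
* So from each vertex `i` there are steps `+1`, `+(n - 1)`, `-(n - 7)`, the first of color `i` and
  the others of color `c i`. A pair of long steps, up and down, advances by `6`. With `k - 1` steps
  up, `k - 2` steps down and `2 k + 3` steps `+1` one goes around the `N`-cycle exactly once in `n`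
  steps, visiting the vertices in such a way that the colors are distinct (`false_of_early`). This
  is a rainbow `n`-cycle.
-/

namespace RainbowSpectrum

/-! ### Rainbow cycles as sequences of vertices -/

/-- The color of an unordered pair of vertices; pairs on the diagonal get the junk value `none`. -/
noncomputable def pairColor {V : Type u} {K : Type v} (γ : SimpleGraph.TopEdgeLabeling V K)
    (e : Sym2 V) : Option K :=
  open Classical in if h : e ∈ (⊤ : SimpleGraph V).edgeSet then some (γ ⟨e, h⟩) else none

/-- A rainbow `n`-cycle of a coloring `col` of the unordered pairs, given by its vertices
`w 0, …, w (n - 1), w n = w 0`. -/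
def HasRainbowSeq {V : Type u} {C : Type v} (col : Sym2 V → C) (n : ℕ) : Prop :=
  ∃ w : ℕ → V, w n = w 0 ∧ (∀ i j, i < j → j < n → w i ≠ w j) ∧
    ∀ i j, i < j → j < n → col s(w i, w (i + 1)) ≠ col s(w j, w (j + 1))

theorem pairColor_eq {V : Type u} {K : Type v} (γ : SimpleGraph.TopEdgeLabeling V K)
    (e : (⊤ : SimpleGraph V).edgeSet) : pairColor γ (e : Sym2 V) = some (γ e) := by
  simp only [pairColor, e.2, dif_pos]

theorem HasRainbowCycle.hasRainbowSeq {V : Type u} {K : Type v}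
    {γ : SimpleGraph.TopEdgeLabeling V K} {n : ℕ} (h : HasRainbowCycle γ n) :
    HasRainbowSeq (pairColor γ) n := by
  obtain ⟨x, p, hc, rfl, hr⟩ := h
  have h3 := hc.three_le_length
  refine ⟨p.getVert, by simp, ?_, ?_⟩
  · intro i j hij hj he
    have := hc.getVert_injOn' (show i ≤ _ by omega) (show j ≤ _ by omega) he
    omega
  · intro i j hij hj he
    have hi : i < p.edges.length := by simp; omega
    have hj' : j < p.edges.length := by simpa using hj
    have h1 := List.getElem_mem hi
    have h2 := List.getElem_mem hj'
    have e1 := pairColor_eq γ ⟨_, p.edges_subset_edgeSet h1⟩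
    have e2 := pairColor_eq γ ⟨_, p.edges_subset_edgeSet h2⟩
    simp only [SimpleGraph.Walk.getElem_edges] at e1 e2
    rw [e1, e2, Option.some_inj] at he
    have h5 := hr (x₁ := ⟨_, p.edges_subset_edgeSet h1⟩) h1
      (x₂ := ⟨_, p.edges_subset_edgeSet h2⟩) h2
      (by simpa only [SimpleGraph.Walk.getElem_edges] using he)
    have h6 := (List.Nodup.getElem_inj_iff hc.edges_nodup).1 (congrArg Subtype.val h5)
    omega

theorem exists_walk_of_seq {V : Type u} {G : SimpleGraph V} (m : ℕ) (w : ℕ → V)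
    (hw : ∀ i < m, G.Adj (w i) (w (i + 1))) :
    ∃ p : G.Walk (w 0) (w m), p.length = m ∧ ∀ i ≤ m, p.getVert i = w i := by
  induction m generalizing w with
  | zero => exact ⟨.nil, rfl, fun i hi => by obtain rfl : i = 0 := by omega
                                             simp⟩
  | succ m ih =>
    obtain ⟨p, hl, hp⟩ := ih (fun i => w (i + 1)) fun i hi => hw (i + 1) (by omega)
    refine ⟨.cons (hw 0 (by omega)) p, by simp [hl], fun i hi => ?_⟩
    cases i with
    | zero => simp
    | succ i => simpa using hp i (by omega)

theorem HasRainbowSeq.hasRainbowCycle {V : Type u} {K : Type v}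
    {γ : SimpleGraph.TopEdgeLabeling V K} {n : ℕ} (hn : 2 ≤ n)
    (h : HasRainbowSeq (pairColor γ) n) : HasRainbowCycle γ n := by
  obtain ⟨w, h0, hv, hcol⟩ := h
  obtain ⟨m, rfl⟩ : ∃ m, n = m + 1 := ⟨n - 1, by omega⟩
  obtain ⟨p, hl, hp⟩ := exists_walk_of_seq (G := ⊤) m w
    fun i hi => hv i (i + 1) (by omega) (by omega)
  have hadj : (⊤ : SimpleGraph V).Adj (w m) (w 0) := (hv 0 m (by omega) (by omega)).symm
  have hedge : ∀ e ∈ p.edges, ∃ i < m, e = s(w i, w (i + 1)) := by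
    intro e he
    induction e with
    | _ a b =>
      obtain ⟨i, hi, hab⟩ := (p.mk_mem_edges_iff_exists).1 he
      exact ⟨i, by omega, by rw [← hab, hp i (by omega), hp (i + 1) (by omega)]⟩
  refine ⟨w m, .cons hadj p, (p.cons_isCycle_iff hadj).2 ⟨?_, ?_⟩, by simp [hl], ?_⟩
  · rw [← SimpleGraph.Walk.IsPath.getVert_injOn_iff]
    intro i hi j hj hij
    simp only [Set.mem_ofPred_eq, hl] at hi hj
    rw [hp i hi, hp j hj] at hij
    rcases lt_trichotomy i j with h | h | h
    · exact absurd hij (hv i j h (by omega))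
    · exact h
    · exact absurd hij.symm (hv j i h (by omega))
  · intro he
    obtain ⟨i, hi, he⟩ := hedge _ he
    exact hcol i m hi (by omega) (by rw [h0, he])
  · have hedge' : ∀ e : (⊤ : SimpleGraph V).edgeSet,
        (e : Sym2 V) ∈ (SimpleGraph.Walk.cons hadj p).edges →
        ∃ i < m + 1, (e : Sym2 V) = s(w i, w (i + 1)) := by
      intro e he
      rw [SimpleGraph.Walk.edges_cons, List.mem_cons] at he
      rcases he with he | he
      · exact ⟨m, by omega, by rw [he, h0]⟩
      · obtain ⟨i, hi, he⟩ := hedge _ he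
        exact ⟨i, by omega, he⟩
    intro e he f hf hef
    obtain ⟨i, hi, hi'⟩ := hedge' e he
    obtain ⟨j, hj, hj'⟩ := hedge' f hf
    have hc : pairColor γ (e : Sym2 V) = pairColor γ (f : Sym2 V) := by
      rw [pairColor_eq, pairColor_eq]
      exact congrArg some hef
    rw [hi', hj'] at hc
    apply Subtype.ext
    rcases lt_trichotomy i j with h | h | h
    · exact absurd hc (hcol i j h (by omega))
    · rw [hi', hj', h]
    · exact absurd hc.symm (hcol j i h (by omega))

/-! ### Periodic numbering of a rainbow cycle -/

/-- A rainbow cycle of length `N` as an `N`-periodic family of vertices indexed by `ℤ`, so that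
the edge `i` joins the vertices `i` and `i + 1`. -/
structure IsRainbowCycleOn {V : Type u} {C : Type v} (col : Sym2 V → C) (N : ℤ) (v : ℤ → V) :
    Prop where
  vert : ∀ i j, v i = v j ↔ N ∣ i - j
  edge : ∀ i j, col s(v i, v (i + 1)) = col s(v j, v (j + 1)) ↔ N ∣ i - j

theorem eq_iff_of_ne_of_lt {X : Type*} {f : ℕ → X} {n : ℕ}
    (hf : ∀ i j, i < j → j < n → f i ≠ f j) (i j : ℕ) (hi : i < n) (hj : j < n) :
    f i = f j ↔ i = j := by
  refine ⟨fun h => ?_, fun h => h ▸ rfl⟩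
  rcases lt_trichotomy i j with hij | hij | hij
  · exact absurd h (hf i j hij hj)
  · exact hij
  · exact absurd h.symm (hf j i hij hi)

theorem HasRainbowSeq.exists_isRainbowCycleOn {V : Type u} {C : Type v} {col : Sym2 V → C} {N : ℕ}
    (hN : 1 ≤ N) (h : HasRainbowSeq col N) : ∃ v : ℤ → V, IsRainbowCycleOn col N v := by
  obtain ⟨w, h0, hv, hcol⟩ := h
  have hpos : (0 : ℤ) < N := by exact_mod_cast hN
  have hlt : ∀ i : ℤ, (i % N).toNat < N := fun i => by
    have := Int.emod_lt_of_pos i hpos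
    have := Int.emod_nonneg i hpos.ne'
    omega
  have hdvd : ∀ i j : ℤ, (N : ℤ) ∣ i - j ↔ (i % N).toNat = (j % N).toNat := fun i j => by
    have := Int.emod_nonneg i hpos.ne'
    have := Int.emod_nonneg j hpos.ne'
    rw [Int.dvd_iff_emod_eq_zero, ← Int.emod_eq_emod_iff_emod_sub_eq_zero]
    omega
  have hsucc : ∀ i : ℤ, w ((i + 1) % N).toNat = w ((i % N).toNat + 1) := fun i => by
    have h1 := Int.emod_lt_of_pos i hpos
    have h2 := Int.emod_nonneg i hpos.ne'
    have h3 : (i + 1) % N = (i % N + 1) % N := by simp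
    rcases (show i % N + 1 < N ∨ i % N + 1 = N by omega) with h | h
    · rw [h3, Int.emod_eq_of_lt (by omega) h]
      congr 1
      omega
    · rw [h3, h, Int.emod_self, show (i % N).toNat + 1 = N by omega, h0]
      rfl
  refine ⟨fun i => w (i % N).toNat, fun i j => ?_, fun i j => ?_⟩
  · rw [hdvd, ← eq_iff_of_ne_of_lt hv _ _ (hlt i) (hlt j)]
  · rw [hdvd, ← eq_iff_of_ne_of_lt hcol _ _ (hlt i) (hlt j)]
    simp only [hsucc]

section Cycles

variable {V : Type u} {C : Type v} {col : Sym2 V → C} {N : ℤ} {v : ℤ → V}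

theorem IsRainbowCycleOn.eq_of_vert_eq (hv : IsRainbowCycleOn col N v) {x y : ℤ} (b : ℤ)
    (hx : b ≤ x ∧ x < b + N) (hy : b ≤ y ∧ y < b + N) (h : v x = v y) : x = y := by
  have := Int.eq_zero_of_abs_lt_dvd ((hv.vert _ _).1 h) (by rw [abs_lt]; omega)
  omega

theorem IsRainbowCycleOn.eq_of_edge_eq (hv : IsRainbowCycleOn col N v) {x y : ℤ} (b : ℤ)
    (hx : b ≤ x ∧ x < b + N) (hy : b ≤ y ∧ y < b + N)
    (h : col s(v x, v (x + 1)) = col s(v y, v (y + 1))) : x = y := by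
  have := Int.eq_zero_of_abs_lt_dvd ((hv.edge _ _).1 h) (by rw [abs_lt]; omega)
  omega

theorem IsRainbowCycleOn.vert_add (hv : IsRainbowCycleOn col N v) {x y : ℤ} (h : y = x + N) :
    v y = v x :=
  (hv.vert _ _).2 ⟨1, by omega⟩

/-- Reversing the orientation. -/
theorem IsRainbowCycleOn.neg (hv : IsRainbowCycleOn col N v) :
    IsRainbowCycleOn col N fun i => v (-i) where
  vert i j := by
    rw [hv.vert, ← dvd_neg]
    ring_nf
  edge i j := by
    have := hv.edge (-i - 1) (-j - 1)
    rw [Sym2.eq_swap, @Sym2.eq_swap _ (v (-j)), show -(i + 1) = -i - 1 by ring,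
      show -(j + 1) = -j - 1 by ring]
    rw [sub_add_cancel, sub_add_cancel] at this
    rw [this, ← dvd_neg]
    ring_nf

/-- If `n` vertices of a rainbow cycle are joined to a path by edges and chords whose colors are
those of distinct edges `q j` of the cycle, and no `n`-cycle is rainbow, then the chord that closes
the path has one of these colors. The integer `b` is the start of a period that contains all the
indices, so that they can be compared as integers. -/
theorem IsRainbowCycleOn.exists_closing_color (hv : IsRainbowCycleOn col N v) {n : ℕ} (hn : 2 ≤ n)
    (hno : ¬ HasRainbowSeq col n) (b : ℤ) (p q : ℕ → ℤ)
    (hp : ∀ j < n, b ≤ p j ∧ p j < b + N) (hpi : ∀ i j, i < j → j < n → p i ≠ p j)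
    (hq : ∀ j < n - 1, b ≤ q j ∧ q j < b + N) (hqi : ∀ i j, i < j → j < n - 1 → q i ≠ q j)
    (hcol : ∀ j < n - 1, col s(v (p j), v (p (j + 1))) = col s(v (q j), v (q j + 1))) :
    ∃ j < n - 1, col s(v (p (n - 1)), v (p 0)) = col s(v (q j), v (q j + 1)) := by
  by_contra! hcon
  refine hno ⟨fun j => if j < n then v (p j) else v (p 0), ?_, ?_, ?_⟩
  · simp
  · intro i j hij hj
    beta_reduce
    rw [if_pos (by omega), if_pos hj]
    exact fun h => hpi i j hij hj (hv.eq_of_vert_eq b (hp i (by omega)) (hp j hj) h)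
  · intro i j hij hj
    beta_reduce
    rw [if_pos (by omega), if_pos (by omega), if_pos hj, hcol i (by omega)]
    rcases (show j < n - 1 ∨ j = n - 1 by omega) with h | rfl
    · rw [if_pos (by omega), hcol j h]
      exact fun he => hqi i j hij h (hv.eq_of_edge_eq b (hq i (by omega)) (hq j h) he)
    · rw [if_neg (by omega)]
      exact (hcon i (by omega)).symm

/-- The form of `IsRainbowCycleOn.exists_closing_color` in which the color of the closing chord is
known as well and differs from the others. -/
theorem IsRainbowCycleOn.false_of_seq (hv : IsRainbowCycleOn col N v) {n : ℕ} (hn : 2 ≤ n)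
    (hno : ¬ HasRainbowSeq col n) (b : ℤ) (p q : ℕ → ℤ)
    (hp : ∀ j < n, b ≤ p j ∧ p j < b + N) (hpi : ∀ i j, i < j → j < n → p i ≠ p j)
    (hpn : p n = p 0 ∨ p n = p 0 + N)
    (hq : ∀ j < n, b ≤ q j ∧ q j < b + N) (hqi : ∀ i j, i < j → j < n → q i ≠ q j)
    (hcol : ∀ j < n, col s(v (p j), v (p (j + 1))) = col s(v (q j), v (q j + 1))) : False := by
  obtain ⟨j, hj, h⟩ := hv.exists_closing_color hn hno b p q hp hpi (fun j hj => hq j (by omega))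
    (fun i j hij hj => hqi i j hij (by omega)) (fun j hj => hcol j (by omega))
  have hv0 : v (p n) = v (p 0) := hpn.elim (fun h => h ▸ rfl) hv.vert_add
  have h1 := hcol (n - 1) (by omega)
  rw [Nat.sub_add_cancel (by omega), hv0, h] at h1
  exact hqi j (n - 1) hj (by omega)
    (hv.eq_of_edge_eq b (hq j (by omega)) (hq _ (by omega)) h1)

theorem col_edge {x y z : ℤ} (hy : y = x + 1) (hz : z = x) :
    col s(v x, v y) = col s(v z, v (z + 1)) := by
  rw [hy, hz]

theorem col_edge' {x y z : ℤ} (hy : x = y + 1) (hz : z = y) :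
    col s(v x, v y) = col s(v z, v (z + 1)) := by
  rw [hy, hz, Sym2.eq_swap]

/-! ### Colors of the chords spanning `n - 1` edges -/

/-- `c` assigns to each chord from `i` to `i + n - 1` an edge of the path from `i` to `i + n - 1`
that has the color of the chord. -/
def IsChordColor (col : Sym2 V → C) (v : ℤ → V) (n : ℕ) (c : ℤ → ℤ) : Prop :=
  ∀ i, (i ≤ c i ∧ c i ≤ i + n - 2) ∧
    col s(v i, v (i + n - 1)) = col s(v (c i), v (c i + 1))

theorem IsChordColor.col_chord {n : ℕ} {c : ℤ → ℤ} (hc : IsChordColor col v n c) {x y z : ℤ}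
    (hy : y = x + n - 1) (hz : z = c x) : col s(v x, v y) = col s(v z, v (z + 1)) := by
  rw [hy, hz, (hc x).2]

theorem IsChordColor.col_chord' {n : ℕ} {c : ℤ → ℤ} (hc : IsChordColor col v n c) {x y z : ℤ}
    (hy : x = y + n - 1) (hz : z = c y) : col s(v x, v y) = col s(v z, v (z + 1)) := by
  rw [hy, hz, Sym2.eq_swap, (hc y).2]

theorem IsRainbowCycleOn.exists_isChordColor (hv : IsRainbowCycleOn col N v) {n : ℕ} (hn : 2 ≤ n)
    (hnN : (n : ℤ) ≤ N) (hno : ¬ HasRainbowSeq col n) : ∃ c, IsChordColor col v n c := by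
  have h : ∀ i : ℤ, ∃ x : ℤ, (i ≤ x ∧ x ≤ i + n - 2) ∧
      col s(v i, v (i + n - 1)) = col s(v x, v (x + 1)) := fun i => by
    obtain ⟨j, hj, h⟩ := hv.exists_closing_color hn hno i (fun j => i + j) (fun j => i + j)
      (fun j hj => by omega) (fun _ _ _ _ => by omega) (fun j hj => by omega)
      (fun _ _ _ _ => by omega) (fun j hj => col_edge (by push_cast; ring) rfl)
    refine ⟨i + j, by omega, ?_⟩
    rw [← h, Sym2.eq_swap]
    congr 4
    · push_cast [show 1 ≤ n by omega]
      ring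
    · simp
  choose c hc using h
  exact ⟨c, hc⟩

theorem IsChordColor.add_period {n : ℕ} {c : ℤ → ℤ} (hc : IsChordColor col v n c)
    (hv : IsRainbowCycleOn col N v) (hnN : (n : ℤ) ≤ N) (i : ℤ) : c (i + N) = c i + N := by
  have h1 := hc i
  have h2 := hc (i + N)
  have h3 : v (i + N) = v i := hv.vert_add rfl
  have h4 : v (i + N + n - 1) = v (i + n - 1) := hv.vert_add (by ring)
  rw [h3, h4, h1.2] at h2
  have h5 := (hv.edge _ _).1 h2.2
  have h6 : N ∣ c i + N - c (i + N) := by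
    rw [show c i + N - c (i + N) = c i - c (i + N) + N by ring]
    exact dvd_add h5 dvd_rfl
  have := Int.eq_zero_of_abs_lt_dvd h6 (by rw [abs_lt]; omega)
  omega

/-- Reversing the orientation exchanges the start and the end of the path spanned by a chord. -/
theorem IsChordColor.neg {n : ℕ} {c : ℤ → ℤ} (hc : IsChordColor col v n c) :
    IsChordColor col (fun i => v (-i)) n fun i => -1 - c (-i - n + 1) := by
  intro i
  have h := hc (-i - n + 1)
  refine ⟨by beta_reduce; omega, ?_⟩
  have e1 : -i - (n : ℤ) + 1 + n - 1 = -i := by ring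
  have e2 : -(i + (n : ℤ) - 1) = -i - n + 1 := by ring
  have e3 : -(-1 - c (-i - n + 1)) = c (-i - n + 1) + 1 := by ring
  have e4 : -(-1 - c (-i - n + 1) + 1) = c (-i - n + 1) := by ring
  simp only [e2, e3, e4]
  rw [Sym2.eq_swap, @Sym2.eq_swap _ (v (c (-i - n + 1) + 1)), ← h.2, e1]

end Cycles

section Dichotomy

variable {V : Type u} {C : Type v} {col : Sym2 V → C} {n : ℕ} {v : ℤ → V} {c : ℤ → ℤ}

/-- The `n`-cycle used here goes along the chord to `i + n - 1`, back along three edges to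
`i + n - 4`, along the second chord to `i + 2 n - 5`, and forward along edges to `i + N`. -/
theorem IsChordColor.late_or_early (hc : IsChordColor col v n c)
    (hv : IsRainbowCycleOn col (3 * n - 10) v) (hn : 12 ≤ n) (hno : ¬ HasRainbowSeq col n) (i : ℤ) :
    i + n - 4 ≤ c i ∨ c (i + n - 4) ≤ i + n - 4 + 2 := by
  by_contra! hcon
  have h1 := (hc i).1
  have h2 := (hc (i + n - 4)).1
  refine hv.false_of_seq (by omega) hno i
    (fun j => if j = 0 then i else if j ≤ 4 then i + n - j else i + 2 * n - 10 + j)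
    (fun j => if j = 0 then c i else if j ≤ 3 then i + n - j - 1 else
      if j = 4 then c (i + n - 4) else i + 2 * n - 10 + j)
    (fun j hj => by omega)
    (fun a b hab hb => by omega)
    (by omega)
    (fun j hj => by omega)
    (fun a b hab hb => by omega)
    (fun j hj => ?_)
  rcases (show j = 0 ∨ 1 ≤ j ∧ j ≤ 3 ∨ j = 4 ∨ 5 ≤ j by omega) with rfl | h | rfl | h
  · exact hc.col_chord (by simp) (by simp)
  · refine col_edge' ?_ ?_ <;> omega
  · refine hc.col_chord ?_ ?_
    · omega
    · simp
  · refine col_edge ?_ ?_ <;> omega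

/-- The `n`-cycle used here goes along the chord to `i + n - 1`, forward along `2 k - 1` edges, back
along the second chord to `i + 2 k - 1`, and back along `2 k - 1` edges to `i`. -/
theorem IsChordColor.crossing {k : ℕ} (hc : IsChordColor col v n c)
    (hv : IsRainbowCycleOn col (3 * n - 10) v) (hk : 3 ≤ k) (hn : n = 4 * k)
    (hno : ¬ HasRainbowSeq col n) (i : ℤ) :
    c i ≤ i + 2 * k - 2 ∨ i + 2 * k - 1 + 2 * k ≤ c (i + 2 * k - 1) ∨ c i = c (i + 2 * k - 1) := by
  by_contra! hcon
  have h1 := (hc i).1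
  have h2 := (hc (i + 2 * k - 1)).1
  refine hv.false_of_seq (by omega) hno i
    (fun j => if j = 0 then i else if j ≤ 2 * k then i + n - 2 + j else i + n - j)
    (fun j => if j = 0 then c i else if j < 2 * k then i + n - 2 + j else
      if j = 2 * k then c (i + 2 * k - 1) else i + n - j - 1)
    (fun j hj => by omega)
    (fun a b hab hb => by omega)
    (by omega)
    (fun j hj => by omega)
    (fun a b hab hb => by omega)
    (fun j hj => ?_)
  rcases (show j = 0 ∨ 1 ≤ j ∧ j < 2 * k ∨ j = 2 * k ∨ 2 * k < j by omega) with rfl | h | h | h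
  · refine hc.col_chord ?_ ?_
    · omega
    · simp
  · refine col_edge ?_ ?_ <;> omega
  · have hx : i + n - ((j + 1 : ℕ) : ℤ) = i + 2 * k - 1 := by omega
    rw [if_neg (by omega), if_pos (by omega), if_neg (by omega), if_neg (by omega),
      if_neg (by omega), if_neg (by omega), if_pos h, hx]
    exact hc.col_chord' (by omega) rfl
  · refine col_edge' ?_ ?_ <;> omega

/-- Every chord has the color of one of the first three edges of its path, or every chord has the
color of one of the last three. -/
theorem IsChordColor.all_early_or_all_late {k : ℕ} (hc : IsChordColor col v n c)
    (hv : IsRainbowCycleOn col (3 * n - 10) v) (hk : 3 ≤ k) (hn : n = 4 * k)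
    (hno : ¬ HasRainbowSeq col n) : (∀ i, c i ≤ i + 2) ∨ ∀ i, i + n - 4 ≤ c i := by
  have hper := fun i => hc.add_period hv (by omega) i
  by_contra! hcon
  obtain ⟨⟨i₁, hi₁⟩, i₀, hi₀⟩ := hcon
  -- Three steps by `n - 4` amount to a step by `-2` modulo the period.
  have hstep : ∀ i, c i < i + n - 4 → c (i - 2) ≤ i - 2 + 2 := by
    intro i hi
    have e0 := hc.late_or_early hv (by omega) hno i
    have e1 := hc.late_or_early hv (by omega) hno (i + n - 4)
    have e2 := hc.late_or_early hv (by omega) hno (i + n - 4 + n - 4)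
    have e3 := hper (i - 2)
    rw [show i - 2 + (3 * (n : ℤ) - 10) = i + n - 4 + n - 4 + n - 4 by ring] at e3
    omega
  have hiter : ∀ i, c i < i + n - 4 → ∀ m : ℕ, c (i - 2 - 2 * m) ≤ i - 2 - 2 * m + 2 := by
    intro i hi m
    induction m with
    | zero => simpa using hstep i hi
    | succ m ih =>
      have := hstep (i - 2 - 2 * m) (by omega)
      rw [show i - 2 - 2 * ((m + 1 : ℕ) : ℤ) = i - 2 - 2 * m - 2 by push_cast; ring]
      omega
  have hmul : ∀ i, ∀ m : ℕ, c (i - m * (3 * n - 10)) = c i - m * (3 * n - 10) := by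
    intro i m
    induction m with
    | zero => simp
    | succ m ih =>
      have := hper (i - ((m + 1 : ℕ) : ℤ) * (3 * n - 10))
      rw [show i - ((m + 1 : ℕ) : ℤ) * (3 * n - 10) + (3 * n - 10) = i - m * (3 * n - 10) by
        push_cast; ring, ih] at this
      push_cast at this ⊢
      linarith
  -- The period `3 n - 10` is even, so going down by steps of two reaches the whole parity class.
  have hclass : ∀ i, c i < i + n - 4 → ∀ j, 2 ∣ i - j → c j ≤ j + 2 := by
    intro i hi j hij
    obtain ⟨t, ht⟩ := hij
    have hN : (3 * (n : ℤ) - 10) = 2 * (6 * k - 5) := by push_cast [hn]; ring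
    have hpos : (1 : ℤ) ≤ 6 * k - 5 := by omega
    have h2 := hmul j (t.natAbs + 1)
    have h3 : 0 ≤ t - 1 + (t.natAbs + 1) * (6 * (k : ℤ) - 5) := by
      nlinarith [neg_abs_le t, Int.natCast_natAbs t, abs_nonneg t]
    have h4 := hiter i hi (t - 1 + (t.natAbs + 1) * (6 * (k : ℤ) - 5)).toNat
    rw [Int.toNat_of_nonneg h3] at h4
    rw [show j - ((t.natAbs + 1 : ℕ) : ℤ) * (3 * n - 10) =
      i - 2 - 2 * (t - 1 + (t.natAbs + 1) * (6 * (k : ℤ) - 5)) by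
        rw [hN]; push_cast; linarith] at h2
    rw [h2, hN] at h4
    push_cast at h4
    linarith
  -- Passing from `i₀` down by the odd number `2 k - 1` links the two parity classes.
  have h0 : c (i₀ - 2 * k + 1) < i₀ - 2 * k + 1 + n - 4 := by
    have h1 := hc.crossing hv hk hn hno (i₀ - 2 * k + 1)
    have h2 := hclass i₀ hi₀ i₀ (by simp)
    rw [show i₀ - 2 * (k : ℤ) + 1 + 2 * k - 1 = i₀ by ring] at h1
    omega
  have h5 := hclass i₀ hi₀ i₁
  have h6 := hclass _ h0 i₁
  omega

/-! ### Colors of the chords spanning `n - 7` edges, and the rainbow `n`-cycle -/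

/-- The chord between `b` and `b - (n - 7)`, which is `b + 2 n - 3` modulo the period, closes the
path that runs along edges from `b` to `b + 2 n - 3`, except that it takes the chord from `b + s` to
`b + s + n - 1`. -/
theorem IsChordColor.exists_outer_chord_color (hc : IsChordColor col v n c)
    (hv : IsRainbowCycleOn col (3 * n - 10) v) (hn : 12 ≤ n) (hno : ¬ HasRainbowSeq col n) (b : ℤ)
    (s : ℕ) (hs : s ≤ n - 2) :
    ∃ x, (b ≤ x ∧ x < b + s ∨ x = c (b + s) ∨ b + s + n - 1 ≤ x ∧ x ≤ b + 2 * n - 4) ∧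
      col s(v b, v (b - (n - 7))) = col s(v x, v (x + 1)) := by
  have h1 := (hc (b + s)).1
  obtain ⟨j, hj, h⟩ := hv.exists_closing_color (by omega) hno b
    (fun j => if j ≤ s then b + j else b + j + n - 2)
    (fun j => if j < s then b + j else if j = s then c (b + s) else b + j + n - 2)
    (fun j hj => by omega)
    (fun _ _ _ _ => by omega)
    (fun j hj => by omega)
    (fun _ _ _ _ => by omega)
    (fun j hj => by
      rcases lt_trichotomy j s with h | rfl | h
      · refine col_edge ?_ ?_ <;> omega
      · refine hc.col_chord ?_ ?_
        · omega
        · simp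
      · refine col_edge ?_ ?_ <;> omega)
  have e1 : v (b - (n - 7)) = v (b + ((n - 1 : ℕ) : ℤ) + n - 2) := (hv.vert_add (by omega)).symm
  rw [if_neg (by omega), if_pos (Nat.zero_le s), ← e1, Sym2.eq_swap, Nat.cast_zero, add_zero] at h
  exact ⟨_, by omega, h⟩

theorem IsChordColor.outer_chord_color (hc : IsChordColor col v n c)
    (hv : IsRainbowCycleOn col (3 * n - 10) v) (hn : 12 ≤ n) (hno : ¬ HasRainbowSeq col n)
    (hearly : ∀ i, c i ≤ i + 2) (b : ℤ) :
    col s(v b, v (b - (n - 7))) = col s(v (c b), v (c b + 1)) := by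
  -- The shifts `0` and `n - 2` leave the colors `c b` and `c (b + n - 2)`. The latter is an edge
  -- between `b + n - 2` and `b + n`, under the chord starting at `b + 3`, so the shift `3`
  -- excludes it.
  obtain ⟨x, hx, hxc⟩ := hc.exists_outer_chord_color hv hn hno b 0 (by omega)
  obtain ⟨y, hy, hyc⟩ := hc.exists_outer_chord_color hv hn hno b 3 (by omega)
  obtain ⟨z, hz, hzc⟩ := hc.exists_outer_chord_color hv hn hno b (n - 2) (by omega)
  simp only [Nat.cast_zero, add_zero] at hx
  have h0 := (hc b).1
  have h3 := (hc (b + (3 : ℕ))).1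
  have h3' := hearly (b + (3 : ℕ))
  have hm := (hc (b + (n - 2 : ℕ))).1
  have hm' := hearly (b + (n - 2 : ℕ))
  have hxy := hv.eq_of_edge_eq b (by omega) (by omega) (hxc.symm.trans hyc)
  have hxz := hv.eq_of_edge_eq b (by omega) (by omega) (hxc.symm.trans hzc)
  obtain rfl : x = c b := by omega
  exact hxc

/-- The rainbow `n`-cycle alternates between lower vertices and upper ones, beginning at `0`, and
ends with a walk along edges up to `N`. Consecutive lower vertices are `6` apart, and so are
consecutive upper ones; since `c i ≤ i + 2`, a distance of `3` suffices for distinct colors. The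
upper vertices are the lower ones shifted by `n - 1`, so the two families, which overlap when `k` is
large, interleave with distance `3` only if `n - 1` is `3` modulo `6`. In general a walk of `d` edges
is inserted after `m` pairs of long steps, when all lower vertices so far are still below the upper
ones. It replaces the offset by `n - 1 - d` where the families overlap. -/
theorem IsChordColor.false_of_early {k : ℕ} (hc : IsChordColor col v n c)
    (hv : IsRainbowCycleOn col (3 * n - 10) v) (hk : 3 ≤ k) (hn : n = 4 * k)
    (hno : ¬ HasRainbowSeq col n) (hearly : ∀ i, c i ≤ i + 2) : False := by
  have hout := hc.outer_chord_color hv (by omega) hno hearly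
  -- The length `d` is chosen such that `n - 1 - d` is `3` modulo `6`.
  obtain ⟨m, d, hm, hd⟩ : ∃ m d : ℕ, 1 ≤ m ∧
      (k = 3 * m + 1 ∧ d = 0 ∨ k = 3 * m + 2 ∧ d = 4 ∨ k = 3 * m ∧ d = 2) := by
    rcases (show k % 3 = 0 ∨ k % 3 = 1 ∨ k % 3 = 2 by omega) with h | h | h
    · exact ⟨k / 3, 2, by omega⟩
    · exact ⟨k / 3, 0, by omega⟩
    · exact ⟨k / 3, 4, by omega⟩
  obtain ⟨p, hp⟩ : ∃ p : ℕ → ℤ, ∀ j, p j =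
      (if j < 2 * m then (if j % 2 = 0 then 3 * j else 3 * j - 4 + n)
      else if j ≤ 2 * m + d then 4 * m + j
      else if j < 2 * k - 3 + d then
        (if j % 2 = 0 then 3 * j - 2 * d else 3 * j - 2 * d - 4 + n)
      else 8 * k - 10 + j : ℤ) := ⟨_, fun _ => rfl⟩
  obtain ⟨q, hq⟩ : ∃ q : ℕ → ℤ, ∀ j, q j =
      if j < 2 * m ∨ 2 * m + d ≤ j ∧ j < 2 * k - 3 + d then c (p j) else p j :=
    ⟨_, fun _ => rfl⟩
  have hqp : ∀ j, p j ≤ q j ∧ q j ≤ p j + 2 := fun j => by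
    have := (hc (p j)).1
    have := hearly (p j)
    rw [hq]
    split_ifs <;> omega
  -- Outside the long steps, the color of a step is the edge itself.
  have hwalk : ∀ j, ¬ (j < 2 * m ∨ 2 * m + d ≤ j ∧ j < 2 * k - 3 + d) → q j = p j :=
    fun j hj => by rw [hq, if_neg hj]
  have hsep : ∀ i j, i < j → j < n → p i + 3 ≤ p j ∨ p j + 3 ≤ p i ∨ p i < p j ∧ q i = p i := by
    intro i j hij hj
    have hi' := hp i
    have hj' := hp j
    have hw := hwalk i
    omega
  refine hv.false_of_seq (by omega) hno 0 p q ?_ ?_ ?_ ?_ ?_ ?_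
  · intro j hj
    have := hp j
    omega
  · intro i j hij hj
    have := hsep i j hij hj
    omega
  · right
    have := hp 0
    have := hp n
    omega
  · intro j hj
    have := hp j
    have := hqp j
    have := hwalk j
    omega
  · intro i j hij hj
    have := hsep i j hij hj
    have := hqp i
    have := hqp j
    omega
  · intro j hj
    have h1 := hp j
    have h2 := hp (j + 1)
    by_cases hch : j < 2 * m ∨ 2 * m + d ≤ j ∧ j < 2 * k - 3 + d
    · have hqj : q j = c (p j) := by rw [hq, if_pos hch]
      by_cases he : j % 2 = 0
      · exact hc.col_chord (by omega) hqj
      · rw [show p (j + 1) = p j - (n - 7) by omega, hout, hqj]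
    · exact col_edge (by omega) (hwalk j hch)

end Dichotomy

theorem not_hasRainbowSeq_of_three_le {V : Type u} {C : Type v} {col : Sym2 V → C} {n k : ℕ}
    (hk : 3 ≤ k) (hn : n = 4 * k) (hno : ¬ HasRainbowSeq col n) :
    ¬ HasRainbowSeq col (3 * n - 10) := by
  intro h
  obtain ⟨v, hv⟩ := h.exists_isRainbowCycleOn (by omega)
  rw [show ((3 * n - 10 : ℕ) : ℤ) = 3 * n - 10 by omega] at hv
  obtain ⟨c, hc⟩ := hv.exists_isChordColor (n := n) (by omega) (by omega) hno
  rcases hc.all_early_or_all_late hv hk hn hno with h | h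
  · exact hc.false_of_early hv hk hn hno h
  · refine hc.neg.false_of_early hv.neg hk hn hno fun i => ?_
    have := h (-i - n + 1)
    omega

/-- The chord from `0` to `7` would need colors on both sides of it. -/
theorem not_hasRainbowSeq_fourteen {V : Type u} {C : Type v} {col : Sym2 V → C}
    (hno : ¬ HasRainbowSeq col 8) : ¬ HasRainbowSeq col 14 := by
  intro h
  obtain ⟨v, hv⟩ := h.exists_isRainbowCycleOn (by omega)
  obtain ⟨c, hc⟩ := hv.exists_isChordColor (n := 8) (by omega) (by norm_num) hno
  have h0 := hc 0
  have h7 := hc 7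
  have e0 : v 14 = v 0 := hv.vert_add (by norm_num)
  norm_num at h0 h7
  rw [e0, Sym2.eq_swap, h0.2] at h7
  have := hv.eq_of_edge_eq 0 (by norm_num; omega) (by norm_num; omega) h7.2
  omega

end RainbowSpectrum

theorem theorem4p4 {V : Type u} {K : Type v} (γ : SimpleGraph.TopEdgeLabeling V K)
    (n k : ℕ) (hk : 1 ≤ k) (hn : n = 4 * k) (hn16 : n ≠ 16) :
    (¬ RainbowSpectrum.HasRainbowCycle γ n →
      ¬ RainbowSpectrum.HasRainbowCycle γ (3 * n - 10)) ∧
    (n ∈ RainbowSpectrum.spectrum γ → 3 * n - 10 ∈ RainbowSpectrum.spectrum γ) := by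
  have key : ¬ RainbowSpectrum.HasRainbowCycle γ n →
      ¬ RainbowSpectrum.HasRainbowCycle γ (3 * n - 10) := by
    intro hno h
    have hno' : ¬ RainbowSpectrum.HasRainbowSeq (RainbowSpectrum.pairColor γ) n :=
      fun h => hno (h.hasRainbowCycle (by omega))
    rcases (show k = 1 ∨ k = 2 ∨ 3 ≤ k by omega) with rfl | rfl | hk3
    -- For `k = 1` the length `3 n - 10` is two, and cycles have at least three edges.
    · obtain ⟨x, p, hp, hl, -⟩ := h
      have := hp.three_le_length
      omega
    · subst hn
      exact RainbowSpectrum.not_hasRainbowSeq_fourteen hno' h.hasRainbowSeq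
    · exact RainbowSpectrum.not_hasRainbowSeq_of_three_le hk3 hn hno' h.hasRainbowSeq
  exact ⟨key, fun h => ⟨by omega, key h.2⟩⟩
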